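/- Let $A=(a_{ki})$ be a $d\times n$ integer matrix whose columns $\underline a_1,\dots,\underline a_n$ generate $\mathbb Z^d$ as a $\mathbb Z$-module, and let $D=\mathbb C[\lambda_1,\dots,\lambda_n]\langle\partial_1,\dots,\partial_n\rangle$ be the $n$-th Weyl algebra. For $\beta\in\mathbb C^d$ let $M_A^\beta$ be the GKZ-system, i.e. the quotient of $D$ by the left ideal generated by the box operators $\Box_l=\prod_{l_i<0}\partial_i^{-l_i}-\prod_{l_i>0}\partial_i^{l_i}$ for all $l\in\mathbb Z^n$ with $\sum_i l_i\underline a_i=0$, and by the operators $E_k-\beta_k$, where $E_k=\sum_{i=1}^n a_{ki}\lambda_i\partial_i$, for $k=1,\dots,d$. Let $\beta,\beta'\in\mathbb C^d$ be such that $\beta-\beta'\in\mathbb NA=\{\sum_i\gamma_i\underline a_i \mid \gamma\in\mathbb N^n\}$, and put $\partial^{\beta-\beta'}:=\prod_{i=1}^n\partial_i^{\gamma_i}$ for any $\gamma\in\mathbb N^n$ with $\beta-\beta'=\sum_i\gamma_i\underline a_i$. Then $[P]\mapsto[P\,\partial^{\beta-\beta'}]$ is a well-defined $D$-linear map $M_A^{\beta'}\to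 M_A^\beta$, independent of the choice of $\gamma$, and every non-zero $D$-linear map $\psi\colon M_A^{\beta'}\to M_A^\beta$ is equal to $c$ times this map for some constant $c\in\mathbb C\setminus\{0\}$. -/

import Mathlib

namespace GKZ

/-- The defining relations of the `n`-th Weyl algebra on the generators `λ_i = Sum.inl i` and
`∂_i = Sum.inr i`. -/
inductive WeylRel (n : ℕ) :
    FreeAlgebra ℂ (Fin n ⊕ Fin n) → FreeAlgebra ℂ (Fin n ⊕ Fin n) → Prop
  | coord_comm (i j : Fin n) : WeylRel n
      (FreeAlgebra.ι ℂ (Sum.inl i) * FreeAlgebra.ι ℂ (Sum.inl j))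
      (FreeAlgebra.ι ℂ (Sum.inl j) * FreeAlgebra.ι ℂ (Sum.inl i))
  | del_comm (i j : Fin n) : WeylRel n
      (FreeAlgebra.ι ℂ (Sum.inr i) * FreeAlgebra.ι ℂ (Sum.inr j))
      (FreeAlgebra.ι ℂ (Sum.inr j) * FreeAlgebra.ι ℂ (Sum.inr i))
  | del_coord (i j : Fin n) : WeylRel n
      (FreeAlgebra.ι ℂ (Sum.inr i) * FreeAlgebra.ι ℂ (Sum.inl j))
      (FreeAlgebra.ι ℂ (Sum.inl j) * FreeAlgebra.ι ℂ (Sum.inr i) + if i = j then 1 else 0)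

/-- The Weyl algebra `D = ℂ[λ_1, …, λ_n]⟨∂_1, …, ∂_n⟩`. -/
abbrev Weyl (n : ℕ) : Type := RingQuot (WeylRel n)

/-- The coordinate `λ_i`. -/
noncomputable def coord {n : ℕ} (i : Fin n) : Weyl n :=
  RingQuot.mkAlgHom ℂ (WeylRel n) (FreeAlgebra.ι ℂ (Sum.inl i))

/-- The partial derivative `∂_i`. -/
noncomputable def del {n : ℕ} (i : Fin n) : Weyl n :=
  RingQuot.mkAlgHom ℂ (WeylRel n) (FreeAlgebra.ι ℂ (Sum.inr i))

/-- The monomial `∂_1 ^ γ_1 ⋯ ∂_n ^ γ_n`. -/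
noncomputable def delPow {n : ℕ} (γ : Fin n → ℕ) : Weyl n :=
  (List.ofFn fun i => del i ^ γ i).prod

/-- The box operator `□_l = ∏_{l_i < 0} ∂_i ^ (-l_i) - ∏_{l_i > 0} ∂_i ^ l_i`; the exponents
are truncated at `0`, so the remaining factors are `1`. -/
noncomputable def box {n : ℕ} (l : Fin n → ℤ) : Weyl n :=
  delPow (fun i => (-l i).toNat) - delPow (fun i => (l i).toNat)

/-- The Euler operator `E_k = ∑_i a_{ki} λ_i ∂_i`. -/
noncomputable def euler {d n : ℕ} (A : Matrix (Fin d) (Fin n) ℤ) (k : Fin d) : Weyl n :=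
  ∑ i, (A k i : ℂ) • (coord i * del i)

/-- The left ideal of `D` generated by the `□_l`, for `l` an integer relation among the columns
of `A`, and by the `E_k - β_k`. -/
noncomputable def hypergeometricIdeal {d n : ℕ} (A : Matrix (Fin d) (Fin n) ℤ)
    (β : Fin d → ℂ) : Submodule (Weyl n) (Weyl n) :=
  Submodule.span (Weyl n)
    ({P | ∃ l : Fin n → ℤ, A.mulVec l = 0 ∧ P = box l} ∪
      {P | ∃ k : Fin d, P = euler A k - algebraMap ℂ (Weyl n) (β k)})

/-- The GKZ-system `M_A^β`, a left `D`-module. -/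
abbrev System {d n : ℕ} (A : Matrix (Fin d) (Fin n) ℤ) (β : Fin d → ℂ) : Type :=
  Weyl n ⧸ hypergeometricIdeal A β

/-- The class `[P]` in `M_A^β` of `P ∈ D`. -/
noncomputable def cls {d n : ℕ} (A : Matrix (Fin d) (Fin n) ℤ) (β : Fin d → ℂ) :
    Weyl n →ₗ[Weyl n] System A β :=
  (hypergeometricIdeal A β).mkQ

/-- `γ ∈ ℕ^n` is an exponent vector for `v ∈ ℂ^d`: `v = ∑_i γ_i a_i`, where the `a_i` are the
columns of `A`. -/
def IsExponent {d n : ℕ} (A : Matrix (Fin d) (Fin n) ℤ) (v : Fin d → ℂ) (γ : Fin n → ℕ) : Prop :=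
  ∀ k, v k = ∑ i, (A k i : ℂ) * (γ i : ℂ)

end GKZ

/-!
A `D`-linear map `ψ : M_A^{β'} → M_A^β` is determined by `m = ψ [1]`, a vector with
`E_k m = β'_k m` that is annihilated by all box operators. Write `θ_i = λ_i ∂_i` and fix `γ ∈ ℕ^n`
with `β - β' = ∑ γ_i a_i`. The theorem says that `m` is a multiple of `[∂^γ]`.

* The class of a normally ordered operator `λ^u ∂^v` is a joint eigenvector of the `E_k`, of weight
  `β + ∑ (u_i - v_i) a_i`. Joint eigenspaces are independent, so `m` is a combination of
  those classes whose weight is `β'`. Because `β - β'` lies in the semigroup `ℕA`, the box operators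
  identify such a class with `[λ^u ∂^u ∂^γ]`, and `λ^u ∂^u` is a polynomial in the `θ_i`. Hence
  `m = [f(θ) ∂^γ]` for a polynomial `f` (`exists_eq_cls_thetaPoly_mul_delPow`).
* `D` acts on all functions on `ℂ^n`, with `∂_i` acting as a shift and `θ_i` as multiplication by
  the coordinate `q_i` (`shiftAction`). The indicator function of `{q | ∑ q_i a_i = β}` solves the
  GKZ-system there, so applying an element of the hypergeometric ideal to it gives zero. Applied to
  `□_l f(θ) ∂^γ`, this shows that `f` is invariant, on the affine subspace `∑ x_i a_i = β'`, under
  translation by each integer relation `l` among the `a_i` (`eval_add_of_box_mul_mem`).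
* As the `a_i` generate `ℤ^d`, the matrix `A` has an integral right inverse `B`. The polynomial
  `f(x - B(Ax - β'))` agrees with `f` modulo the equations `Ax = β'`, and takes a single value on
  `ℤ^n`, so it is a constant `c` (`exists_sub_C_mem_span`). The equations of the subspace, evaluated
  at `θ`, are the operators `E_k - β'_k`, which annihilate `[∂^γ]`; hence `m = c [∂^γ]`.
-/

namespace GKZ

open MvPolynomial

/-! ### The Weyl algebra -/

section CommutingFamily

variable {R : Type*} [Ring R] [Algebra ℂ R] {n : ℕ}

open scoped IsMulCommutative in
/-- `MvPolynomial.aeval` needs a commutative target; the subalgebra generated by a commuting family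
is one. -/
theorem exists_algHom_of_commute (x : Fin n → R) (hx : ∀ i j, x i * x j = x j * x i) :
    ∃ Φ : MvPolynomial (Fin n) ℂ →ₐ[ℂ] R, ∀ i, Φ (X i) = x i := by
  have hcomm : ∀ a ∈ Set.range x, ∀ b ∈ Set.range x, a * b = b * a := by
    rintro _ ⟨i, rfl⟩ _ ⟨j, rfl⟩
    exact hx i j
  have := Algebra.isMulCommutative_adjoin ℂ hcomm
  let y (i : Fin n) : Algebra.adjoin ℂ (Set.range x) := ⟨x i, Algebra.subset_adjoin ⟨i, rfl⟩⟩
  refine ⟨(Algebra.adjoin ℂ (Set.range x)).val.comp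
    (aeval y), fun i => ?_⟩
  simp [y]

/-- Evaluation of polynomials at a commuting family in a possibly noncommutative algebra. -/
noncomputable def evalComm (x : Fin n → R) (hx : ∀ i j, x i * x j = x j * x i) :
    MvPolynomial (Fin n) ℂ →ₐ[ℂ] R :=
  (exists_algHom_of_commute x hx).choose

@[simp] theorem evalComm_X (x : Fin n → R) (hx : ∀ i j, x i * x j = x j * x i) (i : Fin n) :
    evalComm x hx (X i) = x i :=
  (exists_algHom_of_commute x hx).choose_spec i

end CommutingFamily

variable {d n : ℕ}

theorem coord_comm (i j : Fin n) : coord i * coord j = coord j * coord i := by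
  simpa [coord] using RingQuot.mkAlgHom_rel ℂ (WeylRel.coord_comm i j)

theorem del_comm (i j : Fin n) : del i * del j = del j * del i := by
  simpa [del] using RingQuot.mkAlgHom_rel ℂ (WeylRel.del_comm i j)

theorem del_mul_coord (i j : Fin n) :
    del i * coord j = coord j * del i + if i = j then 1 else 0 := by
  have h := RingQuot.mkAlgHom_rel ℂ (WeylRel.del_coord i j)
  split_ifs at h ⊢ <;> simpa [del, coord] using h

theorem theta_comm (i j : Fin n) :
    coord i * del i * (coord j * del j) = coord j * del j * (coord i * del i) := by
  have h1 := del_mul_coord i j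
  have h2 := del_mul_coord j i
  rcases eq_or_ne i j with rfl | hij
  · rfl
  · rw [if_neg hij, add_zero] at h1
    rw [if_neg hij.symm, add_zero] at h2
    calc coord i * del i * (coord j * del j) = coord i * (del i * coord j) * del j := by
          noncomm_ring
      _ = (coord i * coord j) * (del i * del j) := by rw [h1]; noncomm_ring
      _ = (coord j * coord i) * (del j * del i) := by rw [coord_comm, del_comm]
      _ = coord j * (coord i * del j) * del i := by noncomm_ring
      _ = coord j * del j * (coord i * del i) := by rw [← h2]; noncomm_ring

/-- The inclusion `ℂ[λ] → D`. -/
noncomputable def coordPoly : MvPolynomial (Fin n) ℂ →ₐ[ℂ] Weyl n := evalComm coord coord_comm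

/-- The inclusion `ℂ[∂] → D`. -/
noncomputable def delPoly : MvPolynomial (Fin n) ℂ →ₐ[ℂ] Weyl n := evalComm del del_comm

/-- The homomorphism `f ↦ f(θ)` from the polynomial ring to `D`, where `θ_i = λ_i ∂_i`. -/
noncomputable def thetaPoly : MvPolynomial (Fin n) ℂ →ₐ[ℂ] Weyl n :=
  evalComm (fun i => coord i * del i) theta_comm

@[simp] theorem coordPoly_X (i : Fin n) : coordPoly (X i) = coord i := evalComm_X _ _ _

@[simp] theorem delPoly_X (i : Fin n) : delPoly (X i) = del i := evalComm_X _ _ _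

@[simp] theorem thetaPoly_X (i : Fin n) : thetaPoly (X i) = coord i * del i := evalComm_X _ _ _

theorem delPow_eq_delPoly (γ : Fin n → ℕ) :
    delPow γ = delPoly (monomial (Finsupp.equivFunOnFinite.symm γ) 1) := by
  have : monomial (Finsupp.equivFunOnFinite.symm γ) (1 : ℂ) =
      (List.ofFn fun i => (X i : MvPolynomial (Fin n) ℂ) ^ γ i).prod := by
    rw [List.prod_ofFn, monic_monomial_eq, Finsupp.prod_fintype _ _ (by simp)]
    rfl
  rw [this, map_list_prod, List.map_ofFn, delPow]
  congr 2
  ext i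
  simp

theorem delPow_coe (v : Fin n →₀ ℕ) : delPow ⇑v = delPoly (monomial v 1) := by
  rw [delPow_eq_delPoly]
  congr
  ext; rfl

theorem delPow_add (u v : Fin n → ℕ) : delPow (u + v) = delPow u * delPow v := by
  rw [delPow_eq_delPoly, delPow_eq_delPoly, delPow_eq_delPoly, ← map_mul, monomial_mul, one_mul]
  congr
  ext; rfl

theorem delPow_mul_comm (u v : Fin n → ℕ) : delPow u * delPow v = delPow v * delPow u := by
  rw [← delPow_add, ← delPow_add, add_comm]

theorem del_eq_delPow (i : Fin n) : del i = delPow (Finsupp.single i 1) := by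
  rw [delPow_coe, ← delPoly_X, X]

/-- Induction on exponent vectors, raising one entry by `1` at a time. -/
theorem exponent_induction {p : (Fin n →₀ ℕ) → Prop} (h0 : p 0)
    (h : ∀ u i, p u → p (u + Finsupp.single i 1)) (u : Fin n →₀ ℕ) : p u := by
  suffices H : ∀ w, p w → p (w + u) by simpa using H 0 h0
  induction u using Finsupp.induction_linear with
  | zero => simp
  | add f g hf hg => exact fun w hw => by simpa [add_assoc] using hg _ (hf w hw)
  | single i b =>
    induction b with
    | zero => simp
    | succ b ih =>
      exact fun w hw => by simpa [Finsupp.single_add, add_assoc] using h _ i (ih w hw)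

/-- The Leibniz rule `∂_i f(λ) = f(λ) ∂_i + (∂f/∂λ_i)(λ)`. -/
theorem del_mul_coordPoly (i : Fin n) (f : MvPolynomial (Fin n) ℂ) :
    del i * coordPoly f = coordPoly f * del i + coordPoly (pderiv i f) := by
  induction f using MvPolynomial.induction_on with
  | C a =>
    rw [← algebraMap_eq, AlgHom.commutes]
    simp [Algebra.commutes]
  | add p q hp hq => simp only [map_add, mul_add, add_mul, hp, hq]; abel
  | mul_X p j hp =>
    simp only [map_mul, coordPoly_X, Derivation.leibniz, smul_eq_mul, pderiv_X, map_add]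
    rw [← mul_assoc, hp, add_mul, mul_assoc, del_mul_coord]
    rcases eq_or_ne i j with rfl | hij
    · have h : coord i * coordPoly (pderiv i p) = coordPoly (pderiv i p) * coord i := by
        rw [← coordPoly_X, ← map_mul, mul_comm, map_mul]
      simp [mul_add, mul_assoc, h, add_assoc]
    · have h : coord j * coordPoly (pderiv i p) = coordPoly (pderiv i p) * coord j := by
        rw [← coordPoly_X, ← map_mul, mul_comm, map_mul]
      simp [hij, mul_assoc, h]

/-- The mirror image of the Leibniz rule: `g(∂) λ_i = λ_i g(∂) + g_i(∂)`, with `g_i` the `i`-th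
partial derivative of `g`. -/
theorem delPoly_mul_coord (i : Fin n) (g : MvPolynomial (Fin n) ℂ) :
    delPoly g * coord i = coord i * delPoly g + delPoly (pderiv i g) := by
  induction g using MvPolynomial.induction_on with
  | C a =>
    rw [← algebraMap_eq, AlgHom.commutes]
    simp [Algebra.commutes]
  | add p q hp hq => simp only [map_add, mul_add, add_mul, hp, hq]; abel
  | mul_X p j hp =>
    have h : del j * delPoly (pderiv i p) = delPoly (pderiv i p) * del j := by
      rw [← delPoly_X, ← map_mul, mul_comm, map_mul]
    simp only [map_mul, delPoly_X, Derivation.leibniz, smul_eq_mul, pderiv_X, map_add]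
    rw [mul_assoc, del_mul_coord, mul_add, ← mul_assoc, hp, h]
    rcases eq_or_ne i j with rfl | hij
    · simp [add_mul, mul_assoc]; abel
    · simp [hij.symm, add_mul, mul_assoc]

theorem theta_mul_coordPoly_monomial (i : Fin n) (u : Fin n →₀ ℕ) (a : ℂ) :
    coord i * del i * coordPoly (monomial u a) =
      coordPoly (monomial u a) * (coord i * del i) + (u i : ℂ) • coordPoly (monomial u a) := by
  have h : coord i * coordPoly (monomial u a) = coordPoly (monomial u a) * coord i := by
    rw [← coordPoly_X, ← map_mul, mul_comm, map_mul]
  rw [mul_assoc, del_mul_coordPoly, mul_add, ← mul_assoc, h, mul_assoc, ← coordPoly_X,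
    ← map_mul (coordPoly), X_mul_pderiv_monomial, map_nsmul, ← Nat.cast_smul_eq_nsmul ℂ]

theorem delPow_mul_theta (i : Fin n) (v : Fin n → ℕ) :
    delPow v * (coord i * del i) =
      coord i * del i * delPow v + (v i : ℂ) • delPow v := by
  have h (p : MvPolynomial (Fin n) ℂ) : delPoly p * del i = del i * delPoly p := by
    rw [← delPoly_X, ← map_mul, mul_comm, map_mul]
  rw [delPow_eq_delPoly, ← mul_assoc, delPoly_mul_coord, add_mul, mul_assoc, h, mul_assoc, h,
    ← delPoly_X, ← map_mul (delPoly) (X i) (pderiv i _), X_mul_pderiv_monomial, map_nsmul,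
    ← Nat.cast_smul_eq_nsmul ℂ]
  rfl

/-- A subspace of `D` that contains `1` and is stable under left multiplication by the generators is
all of `D`. -/
theorem weyl_induction {S : Submodule ℂ (Weyl n)} (h1 : (1 : Weyl n) ∈ S)
    (hc : ∀ i, ∀ P ∈ S, coord i * P ∈ S) (hd : ∀ i, ∀ P ∈ S, del i * P ∈ S) (P : Weyl n) :
    P ∈ S := by
  suffices H : ∀ Q ∈ S, P * Q ∈ S by simpa using H 1 h1
  obtain ⟨p, rfl⟩ := RingQuot.mkAlgHom_surjective ℂ (WeylRel n) P
  induction p using FreeAlgebra.induction with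
  | grade0 r =>
    intro Q hQ
    rw [AlgHom.commutes, ← Algebra.smul_def]
    exact S.smul_mem r hQ
  | grade1 x =>
    rcases x with i | i
    · exact hc i
    · exact hd i
  | mul a b ha hb =>
    intro Q hQ
    rw [map_mul, mul_assoc]
    exact ha _ (hb _ hQ)
  | add a b ha hb =>
    intro Q hQ
    rw [map_add, add_mul]
    exact S.add_mem (ha _ hQ) (hb _ hQ)

/-- Normal ordering: the operators `λ^u ∂^v` span the Weyl algebra. -/
theorem span_normalOrdered :
    Submodule.span ℂ (Set.range fun w : (Fin n →₀ ℕ) × (Fin n → ℕ) =>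
      (coordPoly (monomial w.1 1) * delPow w.2 : Weyl n)) = ⊤ := by
  set S := Submodule.span ℂ (Set.range fun w : (Fin n →₀ ℕ) × (Fin n → ℕ) =>
      (coordPoly (monomial w.1 1) * delPow w.2 : Weyl n)) with hS
  have hmem (f : MvPolynomial (Fin n) ℂ) (v : Fin n → ℕ) : coordPoly f * delPow v ∈ S := by
    induction f using MvPolynomial.induction_on' with
    | monomial u a =>
      have : monomial u a = a • (monomial u 1 : MvPolynomial (Fin n) ℂ) := by simp [smul_monomial]
      rw [this, map_smul, smul_mul_assoc]
      exact S.smul_mem a (Submodule.subset_span ⟨(u, v), rfl⟩)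
    | add p q hp hq =>
      rw [map_add, add_mul]
      exact S.add_mem hp hq
  refine eq_top_iff.2 fun P _ => weyl_induction ?_ (fun i Q hQ => ?_) (fun i Q hQ => ?_) P
  · have := hmem 1 0
    rwa [map_one, one_mul, show delPow (0 : Fin n → ℕ) = 1 by simp [delPow]] at this
  · have : S ≤ S.comap (LinearMap.mulLeft ℂ (coord i)) := by
      rw [hS, Submodule.span_le]
      rintro _ ⟨⟨u, v⟩, rfl⟩
      change coord i * (_ * _) ∈ S
      rw [← mul_assoc, ← coordPoly_X, ← map_mul]
      exact hmem _ _
    exact this hQ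
  · have : S ≤ S.comap (LinearMap.mulLeft ℂ (del i)) := by
      rw [hS, Submodule.span_le]
      rintro _ ⟨⟨u, v⟩, rfl⟩
      change del i * (_ * _) ∈ S
      rw [← mul_assoc, del_mul_coordPoly, add_mul, mul_assoc, del_eq_delPow, ← delPow_add]
      exact S.add_mem (hmem _ _) (hmem _ _)
    exact this hQ

/-- The operator `λ^u ∂^u` is a polynomial in the `θ_i`. -/
theorem coordPoly_mul_delPow_mem_range (u : Fin n →₀ ℕ) :
    ∃ f, coordPoly (monomial u 1) * delPow u = thetaPoly f := by
  suffices coordPoly (monomial u 1) * delPow u ∈ (thetaPoly (n := n)).range by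
    obtain ⟨f, hf⟩ := this
    exact ⟨f, hf.symm⟩
  induction u using exponent_induction with
  | h0 => simp [delPow, one_mem]
  | h u i ih =>
    have h1 : (coordPoly (monomial (u + Finsupp.single i 1) 1) : Weyl n) =
        coordPoly (monomial u 1) * coord i := by
      rw [← coordPoly_X, ← map_mul, X, monomial_mul, one_mul]
    have h2 : delPow ⇑(u + Finsupp.single i 1 : Fin n →₀ ℕ) = del i * delPow u := by
      rw [Finsupp.coe_add, delPow_add, delPow_mul_comm, del_eq_delPow]
    have h3 : coord i * (del i * delPow u) =
        delPow u * (coord i * del i) - (u i : ℂ) • delPow u := by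
      rw [delPow_mul_theta, add_sub_cancel_right, mul_assoc]
    rw [h1, h2, mul_assoc, h3, mul_sub, mul_smul_comm, ← mul_assoc]
    exact sub_mem (mul_mem ih ⟨X i, thetaPoly_X i⟩) (Subalgebra.smul_mem _ ih _)

/-! ### The action on functions on `ℂ^n` -/

/-- The action of `D` on functions on `ℂ^n` in which `∂_i` is the shift `c ↦ c(· + ε_i)` and
`λ_i` is `c ↦ (q ↦ q_i c(q - ε_i))`, with `ε_i` the standard basis. A function `c` stands for the
formal sum `∑_q c(q) e_q`, where `e_q` plays the role of `λ^q / Γ(q + 1)`, so that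
`∂_i e_q = e_{q - ε_i}`; unlike that quotient, `e_q` is nonzero for every `q`. -/
noncomputable def shiftAction : Weyl n →ₐ[ℂ] Module.End ℂ ((Fin n → ℂ) → ℂ) :=
  RingQuot.liftAlgHom ℂ ⟨FreeAlgebra.lift ℂ (Sum.elim
    (fun i =>
      { toFun := fun c q => q i * c (q - Pi.single i 1)
        map_add' := fun c c' => by ext q; simp [mul_add]
        map_smul' := fun a c => by ext q; simp [mul_left_comm] })
    (fun i =>
      { toFun := fun c q => c (q + Pi.single i 1)
        map_add' := fun c c' => rfl
        map_smul' := fun a c => rfl })), by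
    intro x y h
    induction h with
    | coord_comm i j =>
      refine LinearMap.ext fun c => funext fun q => ?_
      rcases eq_or_ne i j with rfl | hij
      · rfl
      · simp [hij, hij.symm, sub_right_comm, mul_left_comm]
    | del_comm i j =>
      refine LinearMap.ext fun c => funext fun q => ?_
      simp [add_right_comm]
    | del_coord i j =>
      refine LinearMap.ext fun c => funext fun q => ?_
      rcases eq_or_ne i j with rfl | hij
      · simp [add_mul]
      · simp [hij, hij.symm, sub_add_eq_add_sub]⟩

@[simp] theorem shiftAction_coord (i : Fin n) (c : (Fin n → ℂ) → ℂ) (q : Fin n → ℂ) :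
    shiftAction (coord i) c q = q i * c (q - Pi.single i 1) := by
  simp [shiftAction, coord]

@[simp] theorem shiftAction_del (i : Fin n) (c : (Fin n → ℂ) → ℂ) (q : Fin n → ℂ) :
    shiftAction (del i) c q = c (q + Pi.single i 1) := by
  simp [shiftAction, del]

theorem shiftAction_thetaPoly (f : MvPolynomial (Fin n) ℂ) (c : (Fin n → ℂ) → ℂ)
    (q : Fin n → ℂ) : shiftAction (thetaPoly f) c q = eval q f * c q := by
  induction f using MvPolynomial.induction_on generalizing c with
  | C a =>
    rw [← algebraMap_eq, AlgHom.commutes, AlgHom.commutes]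
    simp [Module.algebraMap_end_apply]
  | add f g hf hg => simp [hf, hg, add_mul]
  | mul_X f i hf => simp [hf, mul_assoc]

theorem shiftAction_delPow (v : Fin n → ℕ) (c : (Fin n → ℂ) → ℂ) (q : Fin n → ℂ) :
    shiftAction (delPow v) c q = c (q + fun i => (v i : ℂ)) := by
  obtain ⟨v, rfl⟩ := Finsupp.equivFunOnFinite.surjective v
  change shiftAction (delPow ⇑v) c q = c (q + fun i => (v i : ℂ))
  induction v using exponent_induction generalizing c with
  | h0 => simp [delPow, ← Pi.zero_def]
  | h u i ih =>
    rw [Finsupp.coe_add, delPow_add, map_mul, Module.End.mul_apply, ih, ← del_eq_delPow,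
      shiftAction_del]
    congr 1
    ext j
    simp [Finsupp.single_apply, Pi.single_apply, add_assoc, eq_comm]

/-! ### Exponents and the hypergeometric ideal -/

/-- The linear map `ℂ^n → ℂ^d` given by `A`. -/
noncomputable def colComb (A : Matrix (Fin d) (Fin n) ℤ) : (Fin n → ℂ) →ₗ[ℂ] (Fin d → ℂ) :=
  (A.map (Int.cast : ℤ → ℂ)).mulVecLin

theorem colComb_apply (A : Matrix (Fin d) (Fin n) ℤ) (x : Fin n → ℂ) (k : Fin d) :
    colComb A x k = ∑ i, (A k i : ℂ) * x i := rfl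

theorem isExponent_iff {A : Matrix (Fin d) (Fin n) ℤ} {v : Fin d → ℂ} {γ : Fin n → ℕ} :
    IsExponent A v γ ↔ colComb A (fun i => (γ i : ℂ)) = v := by
  rw [eq_comm, funext_iff]; rfl

theorem colComb_intCast (A : Matrix (Fin d) (Fin n) ℤ) (z : Fin n → ℤ) :
    colComb A (fun i => (z i : ℂ)) = fun k => ((A.mulVec z k : ℤ) : ℂ) := by
  ext k
  simp [colComb_apply, Matrix.mulVec, dotProduct]

theorem mulVec_eq_zero_iff (A : Matrix (Fin d) (Fin n) ℤ) (z : Fin n → ℤ) :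
    A.mulVec z = 0 ↔ colComb A (fun i => (z i : ℂ)) = 0 := by
  simp [colComb_intCast, funext_iff]

theorem box_mem {A : Matrix (Fin d) (Fin n) ℤ} {β : Fin d → ℂ} {l : Fin n → ℤ}
    (hl : A.mulVec l = 0) : box l ∈ hypergeometricIdeal A β :=
  Submodule.subset_span (Or.inl ⟨l, hl, rfl⟩)

theorem euler_sub_mem (A : Matrix (Fin d) (Fin n) ℤ) (β : Fin d → ℂ) (k : Fin d) :
    euler A k - algebraMap ℂ (Weyl n) (β k) ∈ hypergeometricIdeal A β :=
  Submodule.subset_span (Or.inr ⟨k, rfl⟩)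

theorem cls_eq_cls {A : Matrix (Fin d) (Fin n) ℤ} {β : Fin d → ℂ} {P Q : Weyl n} :
    cls A β P = cls A β Q ↔ P - Q ∈ hypergeometricIdeal A β := by
  simp only [cls, Submodule.mkQ_apply]
  exact Submodule.Quotient.eq _

theorem cls_eq_zero {A : Matrix (Fin d) (Fin n) ℤ} {β : Fin d → ℂ} {P : Weyl n} :
    cls A β P = 0 ↔ P ∈ hypergeometricIdeal A β := by
  simp [cls]

/-- Modulo the box operators, `∂^γ` depends only on `∑ γ_i a_i`. -/
theorem delPow_sub_delPow_mem {A : Matrix (Fin d) (Fin n) ℤ} (β : Fin d → ℂ) {γ γ' : Fin n → ℕ}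
    (h : colComb A (fun i => (γ i : ℂ)) = colComb A (fun i => (γ' i : ℂ))) :
    delPow γ - delPow γ' ∈ hypergeometricIdeal A β := by
  -- Splitting off the common factor of `∂^γ` and `∂^γ'` leaves `□_l` for `l = γ' - γ`.
  let l : Fin n → ℤ := fun i => γ' i - γ i
  have hl : A.mulVec l = 0 := by
    rw [mulVec_eq_zero_iff]
    have : (fun i => (l i : ℂ)) = (fun i => (γ' i : ℂ)) - fun i => (γ i : ℂ) := by
      ext i; simp [l]
    rw [this, map_sub, h, sub_self]
  have h1 : γ = (fun i => min (γ i) (γ' i)) + fun i => (-l i).toNat := by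
    ext i; simp only [Pi.add_apply, l]; omega
  have h2 : γ' = (fun i => min (γ i) (γ' i)) + fun i => (l i).toNat := by
    ext i; simp only [Pi.add_apply, l]; omega
  have h3 : delPow γ - delPow γ' = delPow (fun i => min (γ i) (γ' i)) * box l := by
    rw [box, mul_sub, ← delPow_add, ← delPow_add, ← h1, ← h2]
  rw [h3]
  exact Submodule.smul_mem _ _ (box_mem hl)

theorem box_mul_delPow (l : Fin n → ℤ) (γ : Fin n → ℕ) : box l * delPow γ = delPow γ * box l := by
  simp only [box, mul_sub, sub_mul, delPow_mul_comm _ γ]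

theorem delPow_mul_euler (A : Matrix (Fin d) (Fin n) ℤ) (k : Fin d) (v : Fin n → ℕ) :
    delPow v * euler A k =
      euler A k * delPow v + colComb A (fun i => (v i : ℂ)) k • delPow v := by
  simp only [euler, colComb_apply, Finset.mul_sum, Finset.sum_mul, Finset.sum_smul,
    ← Finset.sum_add_distrib]
  refine Finset.sum_congr rfl fun i _ => ?_
  rw [mul_smul_comm, delPow_mul_theta, smul_add, smul_mul_assoc, smul_smul]

theorem euler_mul_coordPoly_monomial (A : Matrix (Fin d) (Fin n) ℤ) (k : Fin d)
    (u : Fin n →₀ ℕ) :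
    euler A k * coordPoly (monomial u 1) = coordPoly (monomial u 1) * euler A k +
      colComb A (fun i => (u i : ℂ)) k • coordPoly (monomial u 1) := by
  simp only [euler, colComb_apply, Finset.mul_sum, Finset.sum_mul, Finset.sum_smul,
    ← Finset.sum_add_distrib]
  refine Finset.sum_congr rfl fun i _ => ?_
  rw [smul_mul_assoc, theta_mul_coordPoly_monomial, smul_add, mul_smul_comm, smul_smul]

/-- Moving `∂^γ` past the Euler operators turns the parameter `β'` into `β`. -/
theorem euler_sub_mul_delPow {A : Matrix (Fin d) (Fin n) ℤ} {β β' : Fin d → ℂ} {γ : Fin n → ℕ}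
    (hγ : IsExponent A (β - β') γ) (k : Fin d) :
    (euler A k - algebraMap ℂ (Weyl n) (β' k)) * delPow γ =
      delPow γ * (euler A k - algebraMap ℂ (Weyl n) (β k)) := by
  rw [isExponent_iff] at hγ
  rw [mul_sub, delPow_mul_euler, hγ, sub_mul, ← Algebra.commutes, Algebra.smul_def,
    Pi.sub_apply, map_sub, sub_mul]
  abel

theorem mul_delPow_mem {A : Matrix (Fin d) (Fin n) ℤ} {β β' : Fin d → ℂ} {γ : Fin n → ℕ}
    (hγ : IsExponent A (β - β') γ) {P : Weyl n} (hP : P ∈ hypergeometricIdeal A β') :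
    P * delPow γ ∈ hypergeometricIdeal A β := by
  induction hP using Submodule.span_induction with
  | zero => rw [zero_mul]; exact zero_mem _
  | add x y _ _ hx hy => rw [add_mul]; exact add_mem hx hy
  | smul a x _ hx => rw [smul_eq_mul, mul_assoc]; exact Submodule.smul_mem _ _ hx
  | mem x hx =>
    rcases hx with ⟨l, hl, rfl⟩ | ⟨k, rfl⟩
    · rw [box_mul_delPow]
      exact Submodule.smul_mem _ _ (box_mem hl)
    · rw [euler_sub_mul_delPow hγ]
      exact Submodule.smul_mem _ _ (euler_sub_mem A β k)

/-- Right multiplication by `∂^γ`, as a map `M_A^{β'} → M_A^β` for `β - β' = ∑ γ_i a_i`. -/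
noncomputable def mulDelPow {A : Matrix (Fin d) (Fin n) ℤ} {β β' : Fin d → ℂ} {γ : Fin n → ℕ}
    (hγ : IsExponent A (β - β') γ) : System A β' →ₗ[Weyl n] System A β :=
  Submodule.mapQ _ _ (LinearMap.toSpanSingleton (Weyl n) (Weyl n) (delPow γ))
    fun _ hP => mul_delPow_mem hγ hP

theorem mulDelPow_cls {A : Matrix (Fin d) (Fin n) ℤ} {β β' : Fin d → ℂ} {γ : Fin n → ℕ}
    (hγ : IsExponent A (β - β') γ) (P : Weyl n) :
    mulDelPow hγ (cls A β' P) = cls A β (P * delPow γ) := rfl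

/-! ### Weight vectors of the GKZ-system -/

/-- The polynomial `∑_i a_{ki} x_i` with `E_k = (∑_i a_{ki} x_i)(θ)`. -/
noncomputable def eulerPoly (A : Matrix (Fin d) (Fin n) ℤ) (k : Fin d) : MvPolynomial (Fin n) ℂ :=
  ∑ i, (A k i : ℂ) • X i

theorem thetaPoly_eulerPoly (A : Matrix (Fin d) (Fin n) ℤ) (k : Fin d) :
    thetaPoly (eulerPoly A k) = euler A k := by
  simp [eulerPoly, euler]

theorem euler_comm (A : Matrix (Fin d) (Fin n) ℤ) (k k' : Fin d) :
    Commute (euler A k) (euler A k') := by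
  rw [← thetaPoly_eulerPoly, ← thetaPoly_eulerPoly]
  exact (Commute.all _ _).map thetaPoly

/-- The class of `λ^u ∂^v` is a weight vector, of weight `β + ∑ (u_i - v_i) a_i`. -/
theorem euler_smul_cls_normalOrdered (A : Matrix (Fin d) (Fin n) ℤ) (β : Fin d → ℂ) (k : Fin d)
    (u : Fin n →₀ ℕ) (v : Fin n → ℕ) :
    euler A k • cls A β (coordPoly (monomial u 1) * delPow v) =
      (β + colComb A (fun i => (u i : ℂ)) - colComb A (fun i => (v i : ℂ))) k •
        cls A β (coordPoly (monomial u 1) * delPow v) := by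
  rw [← map_smul, ← LinearMap.map_smul_of_tower, cls_eq_cls]
  set U : Weyl n := coordPoly (monomial u 1)
  have : euler A k • (U * delPow v) -
      (β + colComb A (fun i => (u i : ℂ)) - colComb A (fun i => (v i : ℂ))) k • (U * delPow v) =
      (U * delPow v) • (euler A k - algebraMap ℂ (Weyl n) (β k)) := by
    rw [smul_eq_mul, smul_eq_mul, mul_sub (U * delPow v), mul_assoc U, delPow_mul_euler,
      ← Algebra.commutes, ← mul_assoc, euler_mul_coordPoly_monomial, mul_add, add_mul,
      ← mul_assoc U, mul_smul_comm, smul_mul_assoc, Pi.sub_apply, Pi.add_apply]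
    simp only [Algebra.smul_def, map_sub, map_add, sub_mul, add_mul]
    abel
  rw [this]
  exact Submodule.smul_mem _ _ (euler_sub_mem A β k)

/-- The action of `D` on the GKZ-system, by `ℂ`-linear endomorphisms. -/
noncomputable abbrev systemAction (A : Matrix (Fin d) (Fin n) ℤ) (β : Fin d → ℂ) :
    Weyl n →ₐ[ℂ] Module.End ℂ (System A β) :=
  Algebra.lsmul ℂ ℂ (System A β)

/-- Every vector of weight `β'` in `M_A^β` is the class of `f(θ) ∂^γ` for some polynomial `f`. -/
theorem exists_eq_cls_thetaPoly_mul_delPow {A : Matrix (Fin d) (Fin n) ℤ} {β β' : Fin d → ℂ}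
    {γ : Fin n → ℕ} (hγ : IsExponent A (β - β') γ) {m : System A β}
    (hm : ∀ k, euler A k • m = β' k • m) :
    ∃ f, m = cls A β (thetaPoly f * delPow γ) := by
  let V (χ : Fin d → ℂ) : Submodule ℂ (System A β) :=
    ⨅ k, (systemAction A β (euler A k)).maxGenEigenspace (χ k)
  have hV {χ : Fin d → ℂ} {x : System A β} (hx : ∀ k, euler A k • x = χ k • x) : x ∈ V χ := by
    refine (Submodule.mem_iInf _).2 fun k => ?_
    exact Module.End.mem_maxGenEigenspace _ _ _ |>.2 ⟨1, by simp [hx]⟩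
  -- The generalized eigenspaces are used because their independence is what Mathlib provides.
  have hind : iSupIndep V := by
    refine Module.End.independent_iInf_maxGenEigenspace_of_forall_mapsTo _ fun i j φ => ?_
    exact Module.End.mapsTo_maxGenEigenspace_of_comm ((euler_comm A j i).map _) φ
  let K : Submodule ℂ (System A β) := LinearMap.range
    ((cls A β).restrictScalars ℂ ∘ₗ LinearMap.mulRight ℂ (delPow γ) ∘ₗ thetaPoly.toLinearMap)
  have hK : K ≤ V β' := by
    rintro _ ⟨f, rfl⟩
    refine hV fun k => ?_
    change euler A k • cls A β (thetaPoly f * delPow γ) = β' k • cls A β (thetaPoly f * delPow γ)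
    rw [← map_smul, ← LinearMap.map_smul_of_tower, cls_eq_cls, Algebra.smul_def, smul_eq_mul,
      ← sub_mul, ← mul_assoc, ← thetaPoly_eulerPoly, ← AlgHom.commutes thetaPoly, ← map_sub,
      ← map_mul, mul_comm, map_mul, map_sub, AlgHom.commutes, thetaPoly_eulerPoly, mul_assoc,
      euler_sub_mul_delPow hγ, ← mul_assoc]
    exact Submodule.smul_mem _ _ (euler_sub_mem A β k)
  -- Each normally ordered monomial lies in `K` if its weight is `β'`, and in another `V χ` if not.
  have htop : m ∈ K ⊔ ⨆ χ, ⨆ _ : χ ≠ β', V χ := by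
    obtain ⟨P, rfl⟩ := Submodule.mkQ_surjective _ m
    have hP : P ∈ Submodule.span ℂ (Set.range fun w : (Fin n →₀ ℕ) × (Fin n → ℕ) =>
      (coordPoly (monomial w.1 1) * delPow w.2 : Weyl n)) := by
      rw [span_normalOrdered]; trivial
    clear hm
    induction hP using Submodule.span_induction with
    | zero => rw [map_zero]; exact zero_mem _
    | add x y _ _ hx hy => rw [map_add]; exact add_mem hx hy
    | smul a x _ hx =>
      rw [LinearMap.map_smul_of_tower]; exact Submodule.smul_mem _ _ hx
    | mem x hx =>
      obtain ⟨⟨u, v⟩, rfl⟩ := hx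
      set χ := β + colComb A (fun i => (u i : ℂ)) - colComb A (fun i => (v i : ℂ)) with hχ
      by_cases h : χ = β'
      · refine Submodule.mem_sup_left ?_
        obtain ⟨f, hf⟩ := coordPoly_mul_delPow_mem_range u
        refine ⟨f, ?_⟩
        change cls A β (thetaPoly f * delPow γ) = cls A β (coordPoly (monomial u 1) * delPow v)
        rw [← hf, mul_assoc, ← delPow_add, cls_eq_cls, ← mul_sub]
        refine Submodule.smul_mem _ _ (delPow_sub_delPow_mem β ?_)
        have : (fun i => (((⇑u + γ) i : ℕ) : ℂ)) = (fun i => (u i : ℂ)) + fun i => (γ i : ℂ) := by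
          ext i; simp
        rw [this, map_add, isExponent_iff.1 hγ, ← h, hχ]
        abel
      · refine Submodule.mem_sup_right ?_
        refine Submodule.mem_iSup_of_mem χ (Submodule.mem_iSup_of_mem h (hV fun k => ?_))
        exact euler_smul_cls_normalOrdered A β k u v
  obtain ⟨x, hx, y, hy, rfl⟩ := Submodule.mem_sup.1 htop
  have hy' : y ∈ V β' := by
    simpa using (V β').sub_mem (hV hm) (hK hx)
  have hy0 : y = 0 := by
    simpa using (Submodule.disjoint_def.1 (hind β')) y hy' hy
  obtain ⟨f, rfl⟩ := hx
  exact ⟨f, by rw [hy0, add_zero]; rfl⟩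

/-! ### Vectors killed by the box operators -/

open Classical in
/-- The indicator function of the affine subspace `{q | ∑ q_i a_i = β}` of `ℂ^n`; a solution of
the GKZ-system in the module of functions on `ℂ^n`. -/
noncomputable def fiberIndicator (A : Matrix (Fin d) (Fin n) ℤ) (β : Fin d → ℂ)
    (q : Fin n → ℂ) : ℂ :=
  if colComb A q = β then 1 else 0

theorem eval_eulerPoly (A : Matrix (Fin d) (Fin n) ℤ) (k : Fin d) (q : Fin n → ℂ) :
    eval q (eulerPoly A k) = colComb A q k := by
  simp [eulerPoly, colComb_apply, smul_eval]

theorem toNat_eq_toNat_neg_add (l : Fin n → ℤ) :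
    (fun i => (((l i).toNat : ℕ) : ℂ)) =
      (fun i => (((-l i).toNat : ℕ) : ℂ)) + fun i => (l i : ℂ) := by
  ext i
  have : ((l i).toNat : ℤ) = (-l i).toNat + l i := by omega
  have h := congrArg (Int.cast : ℤ → ℂ) this
  rwa [Int.cast_add, Int.cast_natCast, Int.cast_natCast] at h

/-- The annihilator of the indicator function contains the hypergeometric ideal, since the shift by
`l` preserves the fibres of `A` and `E_k` acts as multiplication by the `k`-th coordinate of
`∑ q_i a_i`. -/
theorem shiftAction_fiberIndicator {A : Matrix (Fin d) (Fin n) ℤ} {β : Fin d → ℂ} {P : Weyl n}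
    (hP : P ∈ hypergeometricIdeal A β) : shiftAction P (fiberIndicator A β) = 0 := by
  induction hP using Submodule.span_induction with
  | zero => simp
  | add x y _ _ hx hy => simp [hx, hy]
  | smul a x _ hx => simp [hx]
  | mem x hx =>
    ext q
    rcases hx with ⟨l, hl, rfl⟩ | ⟨k, rfl⟩
    · rw [mulVec_eq_zero_iff] at hl
      simp only [box, map_sub, LinearMap.sub_apply, Pi.sub_apply, shiftAction_delPow,
        Pi.zero_apply, fiberIndicator, toNat_eq_toNat_neg_add l, map_add, hl, add_zero, sub_self]
    · rw [← thetaPoly_eulerPoly, map_sub, LinearMap.sub_apply, Pi.sub_apply,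
        shiftAction_thetaPoly, AlgHom.commutes, eval_eulerPoly, fiberIndicator]
      split_ifs with h
      · simp [h, fiberIndicator]
      · simp [h, fiberIndicator]

/-- If `f(θ) ∂^γ` is annihilated by `□_l` in `M_A^β`, then `f` is invariant under translation by
`l` on the affine subspace `∑ x_i a_i = β'`. -/
theorem eval_add_of_box_mul_mem {A : Matrix (Fin d) (Fin n) ℤ} {β β' : Fin d → ℂ}
    {γ : Fin n → ℕ} (hγ : IsExponent A (β - β') γ) {l : Fin n → ℤ} (hl : A.mulVec l = 0)
    {f : MvPolynomial (Fin n) ℂ}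
    (hf : box l * (thetaPoly f * delPow γ) ∈ hypergeometricIdeal A β)
    {x : Fin n → ℂ} (hx : colComb A x = β') :
    eval (x + fun i => (l i : ℂ)) f = eval x f := by
  rw [mulVec_eq_zero_iff] at hl
  rw [isExponent_iff] at hγ
  -- At `x - l⁻`, the two monomials of `□_l` shift the argument to `x` and to `x - l⁻ + l⁺ = x + l`.
  have h := congrFun (shiftAction_fiberIndicator hf) (x - fun i => (((-l i).toNat : ℕ) : ℂ))
  simp only [box, sub_mul, map_sub, map_mul, Module.End.mul_apply, LinearMap.sub_apply,
    Pi.sub_apply, shiftAction_delPow, shiftAction_thetaPoly, Pi.zero_apply,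
    toNat_eq_toNat_neg_add l,
    sub_add_cancel, fiberIndicator, map_add, hx, hγ, hl, ← add_assoc, add_zero,
    add_sub_cancel, if_true, mul_one] at h
  exact (sub_eq_zero.1 h).symm

theorem exists_mul_eq_one {A : Matrix (Fin d) (Fin n) ℤ}
    (hA : Submodule.span ℤ (Set.range fun (i : Fin n) (k : Fin d) => A k i) = ⊤) :
    ∃ B : Matrix (Fin n) (Fin d) ℤ, A * B = 1 := by
  rw [← Matrix.mulVec_surjective_iff_exists_right_inverse]
  have : LinearMap.range A.mulVecLin = ⊤ := by
    rw [Matrix.range_mulVecLin]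
    exact hA
  exact LinearMap.range_eq_top.1 this

/-- A polynomial that is invariant, on the affine subspace `∑ x_i a_i = β'`, under translation by
the integer relations among the `a_i` is constant modulo the equations of this subspace. -/
theorem exists_sub_C_mem_span {A : Matrix (Fin d) (Fin n) ℤ}
    (hA : Submodule.span ℤ (Set.range fun (i : Fin n) (k : Fin d) => A k i) = ⊤)
    {β' : Fin d → ℂ} {f : MvPolynomial (Fin n) ℂ}
    (hf : ∀ l : Fin n → ℤ, A.mulVec l = 0 → ∀ x, colComb A x = β' →
      eval (x + fun i => (l i : ℂ)) f = eval x f) :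
    ∃ c : ℂ, f - C c ∈ Ideal.span (Set.range fun k => eulerPoly A k - C (β' k)) := by
  obtain ⟨B, hB⟩ := exists_mul_eq_one hA
  set J := Ideal.span (Set.range fun k => eulerPoly A k - C (β' k)) with hJ
  -- The substitution `x ↦ x - B (A x - β')`, which maps `ℂ^n` into the affine subspace.
  let s (i : Fin n) : MvPolynomial (Fin n) ℂ :=
    X i - ∑ k, C (B i k : ℂ) * (eulerPoly A k - C (β' k))
  have hs (i : Fin n) : X i - s i ∈ J := by
    simp only [s, sub_sub_cancel]
    exact sum_mem fun k _ => J.mul_mem_left _ (Ideal.subset_span ⟨k, rfl⟩)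
  have h1 : f - aeval s f ∈ J := by
    rw [← Ideal.Quotient.mk_eq_mk_iff_sub_mem]
    have : (Ideal.Quotient.mkₐ ℂ J) = (Ideal.Quotient.mkₐ ℂ J).comp (aeval s) := by
      refine MvPolynomial.algHom_ext fun i => ?_
      simpa using (Ideal.Quotient.mk_eq_mk_iff_sub_mem _ _).2 (hs i)
    exact congrArg (fun φ : MvPolynomial (Fin n) ℂ →ₐ[ℂ] _ => φ f) this
  let p : Fin n → ℂ := colComb B β'
  have hp : colComb A p = β' := by
    change (A.map _).mulVec ((B.map _).mulVec β') = β'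
    have := congrArg (fun M : Matrix (Fin d) (Fin d) ℤ => M.map (Int.castRingHom ℂ)) hB
    simp only [Matrix.map_mul, Matrix.map_one _ (map_zero _) (map_one _)] at this
    rw [Matrix.mulVec_mulVec]
    erw [this]
    exact Matrix.one_mulVec _
  have h2 : aeval s f = C (eval p f) := by
    refine MvPolynomial.funext_set (fun _ => Set.range (Int.cast : ℤ → ℂ))
      (fun _ => Set.infinite_range_of_injective Int.cast_injective) fun x hx => ?_
    choose z hz using fun i => hx i trivial
    obtain rfl : (fun i => (z i : ℂ)) = x := funext hz
    -- `s` maps `z ∈ ℤ^n` to `B β' + (z - B A z)`, where the second summand is an integer relation.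
    have hl : A.mulVec (z - B.mulVec (A.mulVec z)) = 0 := by
      rw [Matrix.mulVec_sub, Matrix.mulVec_mulVec, hB, Matrix.one_mulVec, sub_self]
    rw [eval_C, ← hf _ hl p hp, ← coe_aeval_eq_eval, ← coe_aeval_eq_eval]
    change (aeval _).comp (aeval s) f = aeval _ f
    congr 1
    refine MvPolynomial.algHom_ext fun i => ?_
    have hz := congrFun (colComb_intCast B (A.mulVec z)) i
    rw [← colComb_intCast, Matrix.mulVec_mulVec] at hz
    simp [s, p, eval_eulerPoly, ← hz, mul_sub, colComb_apply B]
    abel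
  exact ⟨eval p f, h2 ▸ h1⟩

/-- If `g` lies in the ideal of the equations `∑ x_i a_i = β'`, then `g(θ)` annihilates `[∂^γ]`. -/
theorem thetaPoly_mul_delPow_mem {A : Matrix (Fin d) (Fin n) ℤ} {β β' : Fin d → ℂ}
    {γ : Fin n → ℕ} (hγ : IsExponent A (β - β') γ) {g : MvPolynomial (Fin n) ℂ}
    (hg : g ∈ Ideal.span (Set.range fun k => eulerPoly A k - C (β' k))) :
    thetaPoly g * delPow γ ∈ hypergeometricIdeal A β := by
  refine mul_delPow_mem hγ ?_
  induction hg using Submodule.span_induction with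
  | zero => simp
  | add x y _ _ hx hy => rw [map_add]; exact add_mem hx hy
  | smul a x _ hx => rw [smul_eq_mul, map_mul]; exact Submodule.smul_mem _ _ hx
  | mem x hx =>
    obtain ⟨k, rfl⟩ := hx
    rw [map_sub, thetaPoly_eulerPoly, ← algebraMap_eq, AlgHom.commutes]
    exact euler_sub_mem A β' k

end GKZ

theorem mainTheorem11 {d n : ℕ} (A : Matrix (Fin d) (Fin n) ℤ)
    (hA : Submodule.span ℤ (Set.range fun (i : Fin n) (k : Fin d) => A k i) = ⊤)
    (β β' : Fin d → ℂ) (hβ : ∃ γ : Fin n → ℕ, GKZ.IsExponent A (β - β') γ) :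
    ∃ ρ : GKZ.System A β' →ₗ[GKZ.Weyl n] GKZ.System A β,
      (∀ γ : Fin n → ℕ, GKZ.IsExponent A (β - β') γ →
        ∀ P : GKZ.Weyl n, ρ (GKZ.cls A β' P) = GKZ.cls A β (P * GKZ.delPow γ)) ∧
      ∀ ψ : GKZ.System A β' →ₗ[GKZ.Weyl n] GKZ.System A β, ψ ≠ 0 →
        ∃ c : ℂ, c ≠ 0 ∧ ψ = c • ρ := by
  obtain ⟨γ, hγ⟩ := hβ
  refine ⟨GKZ.mulDelPow hγ, fun γ' hγ' P => ?_, fun ψ hψ => ?_⟩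
  · rw [GKZ.mulDelPow_cls, GKZ.cls_eq_cls, ← mul_sub]
    exact Submodule.smul_mem _ _ (GKZ.delPow_sub_delPow_mem β
      ((GKZ.isExponent_iff.1 hγ).trans (GKZ.isExponent_iff.1 hγ').symm))
  · have hkill {P : GKZ.Weyl n} (hP : P ∈ GKZ.hypergeometricIdeal A β') :
        P • ψ (GKZ.cls A β' 1) = 0 := by
      rw [← map_smul, ← map_smul, smul_eq_mul, mul_one, GKZ.cls_eq_zero.2 hP, map_zero]
    obtain ⟨f, hf⟩ := GKZ.exists_eq_cls_thetaPoly_mul_delPow hγ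
      (m := ψ (GKZ.cls A β' 1)) fun k => by
        simpa [sub_smul, sub_eq_zero] using hkill (GKZ.euler_sub_mem A β' k)
    obtain ⟨c, hc⟩ := GKZ.exists_sub_C_mem_span hA (β' := β') (f := f) fun l hl x hx => by
      refine GKZ.eval_add_of_box_mul_mem hγ hl ?_ hx
      rw [← GKZ.cls_eq_zero, ← smul_eq_mul, map_smul, ← hf]
      exact hkill (GKZ.box_mem hl)
    have h1 : ψ (GKZ.cls A β' 1) = c • GKZ.mulDelPow hγ (GKZ.cls A β' 1) := by
      rw [hf, GKZ.mulDelPow_cls, ← LinearMap.map_smul_of_tower, GKZ.cls_eq_cls, one_mul,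
        Algebra.smul_def, ← AlgHom.commutes GKZ.thetaPoly, ← sub_mul, ← map_sub]
      exact GKZ.thetaPoly_mul_delPow_mem hγ hc
    have h2 : ψ = c • GKZ.mulDelPow hγ := by
      refine LinearMap.ext fun x => ?_
      obtain ⟨P, rfl⟩ := Submodule.mkQ_surjective _ x
      have hP : GKZ.cls A β' P = P • GKZ.cls A β' 1 := by
        rw [← map_smul, smul_eq_mul, mul_one]
      change ψ (GKZ.cls A β' P) = c • GKZ.mulDelPow hγ (GKZ.cls A β' P)
      rw [hP, map_smul, map_smul, h1, smul_comm]
    refine ⟨c, ?_, h2⟩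
    rintro rfl
    exact hψ (LinearMap.ext fun x => by rw [h2]; exact zero_smul ℂ (GKZ.mulDelPow hγ x))
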